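/- Let $K$ be a field of characteristic $0$, let $L$ be a Lie algebra over $K$ with a basis $(X_i)_{i\in I}$ (the index set $I$ may be finite or infinite), and let $\mathcal A=K\langle X_i : i\in I\rangle$ be the algebra of non-commutative polynomials in the $X_i$; regard $L$ as the space of homogeneous polynomials of degree one in $\mathcal A$. A trinomial product is a polynomial $P(XY-YX-[X,Y])Q$ with $P,Q\in\mathcal A$ and $X,Y\in L$. Two polynomials $p,q\in\mathcal A$ are called equivalent, $p\sim q$, if $p-q$ is a linear combination of trinomial products. A polynomial is called regular if it is a linear combination of powers $\left(\sum_i c_iX_i\right)^m$, where $m\ge 0$ and $c_i\in K$, all but finitely many $c_i$ being $0$. A polynomial is called symmetric if any two monomials that differ only by the order of their factors have the same coefficient in it. Then: 1. Every polynomial in $\mathcal A$ is equivalent to exactly one regular polynomial. 2. A polynomial in $\mathcal A$ is regular if and only if it is symmetric. 3. Every linear combination of trinomial products that is a regular polynomial is zero. 4. There is a $K$-linear isomorphism $\omega\colon S(L)\to U(L)$ from the symmetric algebra of $L$ onto its universal enveloping algebra such that $$\omega(x_1x_2\cdots x_m)=\frac1{m!}\sum_{\sigma\in\mathfrak S_m}x_{\sigma(1)}x_{\sigma(2)}\cdots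 x_{\sigma(m)}$$ for all $m\ge 0$ and all $x_1,\dots,x_m\in L$, where the product on the left is taken in $S(L)$ and the products on the right in $U(L)$. -/

import Mathlib

namespace SymbolicPoly

/-- The algebra of non-commutative polynomials with coefficients in `K` in indeterminates `X i`,
`i : κ`. -/
abbrev Poly (K κ : Type*) [Field K] : Type _ := FreeAlgebra K κ

section Regular

variable (K κ : Type*) [Field K]

/-- The linear form `∑ i, c i * X i`, as a linear map in its (finitely supported) coefficients. -/
noncomputable def linForm : (κ →₀ K) →ₗ[K] Poly K κ :=
  Finsupp.linearCombination K (FreeAlgebra.ι K)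

/-- The vector space of regular polynomials: the linear combinations of powers (the exponent `0`
included) of linear forms. -/
def regular : Submodule K (Poly K κ) :=
  Submodule.span K {q | ∃ (c : κ →₀ K) (m : ℕ), q = linForm K κ c ^ m}

end Regular

section Symmetric

variable {K κ : Type*} [Field K]

/-- The coefficient of the non-commutative monomial `X i₁ ⋯ X iₘ`, where `w = [i₁, …, iₘ]`. -/
noncomputable def coeff (p : Poly K κ) (w : List κ) : K :=
  (FreeAlgebra.equivMonoidAlgebraFreeMonoid p : MonoidAlgebra K (FreeMonoid κ)).coeff
    (FreeMonoid.ofList w)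

/-- A polynomial is symmetric if monomials that differ only by the order of their factors have the
same coefficient in it. -/
def IsSymmetric (p : Poly K κ) : Prop :=
  ∀ u v : List κ, u.Perm v → coeff p u = coeff p v

end Symmetric

section Equivalence

variable {K κ L : Type*} [Field K] [LieRing L] [LieAlgebra K L]

/-- The element of `L` with coordinates `c` in the basis `b`, seen as the polynomial `∑ i, c i X i`
of degree one. -/
noncomputable def ofLie (b : Module.Basis κ K L) : L →ₗ[K] Poly K κ :=
  linForm K κ ∘ₗ b.repr.toLinearMap

/-- The trinomial product `P (X Y - Y X - [X, Y]) Q`. -/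
noncomputable def trinomial (b : Module.Basis κ K L) (P : Poly K κ) (x y : L) (Q : Poly K κ) :
    Poly K κ :=
  P * (ofLie b x * ofLie b y - ofLie b y * ofLie b x - ofLie b ⁅x, y⁆) * Q

/-- The linear combinations of trinomial products. -/
def trinomialSums (b : Module.Basis κ K L) : Submodule K (Poly K κ) :=
  Submodule.span K {q | ∃ (P : Poly K κ) (x y : L) (Q : Poly K κ), q = trinomial b P x y Q}

/-- Two polynomials are equivalent if their difference is a sum of trinomial products. -/
def Equivalent (b : Module.Basis κ K L) (p q : Poly K κ) : Prop :=
  p - q ∈ trinomialSums b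

end Equivalence

end SymbolicPoly

/-! Averaging products over all orders gives a linear section `symmetrize` of the projection `toSym`
onto the symmetric algebra. By polarization (`symProd_eq_sum_pow`) its image consists of
combinations of powers, and `symmetrize ∘ toSym` averages coefficients over rearrangements; so
regular, symmetric and "in the image of `symmetrize`" mean the same thing.

Existence of a regular representative is an induction on degree: modulo trinomial products,
exchanging adjacent letters costs only a term of lower degree, so a word may be replaced by its
average (`word_mem_sup`).

Uniqueness needs a representation ρ = `leftAct` of `L` on `S(L)` under which `y ^ m` applied to `1`
gives `y ^ m`. In `U(L)` the derivative of `e^y` in the direction `v` is `(φ(ad y) v) e^y`, with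
`φ(z) = (e^z - 1)/z`. This forces `ρ(φ(ad y) v) e^y = v e^y` in `S(L)`, that is, `ρ(v) e^y = (φ(ad
y)⁻¹ v) e^y`, whose coefficients are Bernoulli numbers. Taking the latter as the definition, one
must prove that ρ respects brackets (`leftAct_lie`). Differentiate the former in the direction `u`,
antisymmetrize in `u, v`, and use the Maurer–Cartan equation (`smul_adPowDeriv_sub`) for `φ(ad y)`.
Exponentials are handled degree by degree in `y`, through divided powers.

Acting on `1` then inverts symmetrization into `U(L)` on the left. Since trinomial products vanish
in `U(L)`, a regular sum of them is zero, and the isomorphism follows. -/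

namespace SymbolicPoly

open Finset

/-! ### Symmetrized products and polarization. -/

section SymProd

variable (K : Type*) [Field K]

/-- The average of the products of `x 0, …, x (m - 1)` in all orders, as a multilinear map. -/
noncomputable def symProd (m : ℕ) (A : Type*) [Ring A] [Algebra K A] :
    MultilinearMap K (fun _ : Fin m => A) A :=
  (m.factorial : K)⁻¹ • ∑ σ : Equiv.Perm (Fin m),
    (MultilinearMap.mkPiAlgebraFin K m A).domDomCongr σ

variable {K} {A B : Type*} [Ring A] [Algebra K A] [Ring B] [Algebra K B]

theorem symProd_apply {m : ℕ} (x : Fin m → A) :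
    symProd K m A x = (m.factorial : K)⁻¹ •
      ∑ σ : Equiv.Perm (Fin m), (List.ofFn fun i => x (σ i)).prod := by
  simp [symProd]

theorem symProd_comp_perm {m : ℕ} (x : Fin m → A) (τ : Equiv.Perm (Fin m)) :
    symProd K m A (x ∘ τ) = symProd K m A x := by
  simp only [symProd_apply, Function.comp_apply]
  congr 1
  exact Fintype.sum_equiv (Equiv.mulLeft τ) _ _ fun σ => rfl

theorem symProd_const [CharZero K] (m : ℕ) (a : A) : symProd K m A (fun _ => a) = a ^ m := by
  rw [symProd_apply]
  simp only [List.ofFn_const, List.prod_replicate, sum_const, card_univ, Fintype.card_perm,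
    Fintype.card_fin]
  rw [← Nat.cast_smul_eq_nsmul K, smul_smul, inv_mul_cancel₀ (Nat.cast_ne_zero.2 m.factorial_ne_zero), one_smul]

theorem map_symProd (f : A →ₐ[K] B) {m : ℕ} (x : Fin m → A) :
    f (symProd K m A x) = symProd K m B (f ∘ x) := by
  simp [symProd_apply, map_list_prod, List.map_ofFn, Function.comp_def]

theorem symProd_eq_prod [CharZero K] {S : Type*} [CommRing S] [Algebra K S] {m : ℕ}
    (x : Fin m → S) : symProd K m S x = ∏ i, x i := by
  rw [symProd_apply]
  have h : ∀ σ : Equiv.Perm (Fin m), (List.ofFn fun i => x (σ i)).prod = ∏ i, x i := fun σ => by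
    rw [List.prod_ofFn]
    exact Equiv.prod_comp σ x
  simp only [h, sum_const, card_univ, Fintype.card_perm, Fintype.card_fin]
  rw [← Nat.cast_smul_eq_nsmul K, smul_smul, inv_mul_cancel₀ (Nat.cast_ne_zero.2 m.factorial_ne_zero), one_smul]

/-- Alternating sums over the subsets that contain the range of a function from a set to itself. -/
theorem sum_neg_one_pow_card_of_range_subset {m : ℕ} (r : Fin m → Fin m) :
    (∑ s : Finset (Fin m), if ∀ i, r i ∈ s then (-1 : K) ^ #s else 0) =
      if Function.Bijective r then (-1) ^ m else 0 := by
  classical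
  split_ifs with hr
  · rw [sum_eq_single univ]
    · simp
    · intro s _ hs
      rw [if_neg]
      intro h
      refine hs (eq_univ_iff_forall.2 fun i => ?_)
      obtain ⟨j, rfl⟩ := hr.2 i
      exact h j
    · simp
  · have : ∃ i, ∀ j, r j ≠ i := by
      by_contra! h
      exact hr (Finite.surjective_iff_bijective.1 h)
    obtain ⟨i, hi⟩ := this
    -- Toggling a point `i` outside the range of `r` preserves the containment condition and
    -- reverses the sign.
    refine sum_involution (fun s _ => if i ∈ s then s.erase i else insert i s) ?_ ?_ ?_ ?_
    · intro s _
      by_cases his : i ∈ s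
      · have h1 : (∀ j, r j ∈ s.erase i) ↔ ∀ j, r j ∈ s := by simp [hi]
        have h2 := card_erase_add_one his
        simp only [his, if_true, h1, ← h2, pow_succ]
        split_ifs <;> simp
      · have h1 : (∀ j, r j ∈ insert i s) ↔ ∀ j, r j ∈ s := by simp [hi]
        simp only [his, if_false, h1, card_insert_of_notMem his, pow_succ]
        split_ifs <;> simp
    · intro s _ _
      by_cases his : i ∈ s
      · simp only [his, if_true]
        intro h
        rw [← h] at his
        simp at his
      · simp only [his, if_false]
        intro h
        exact his (h ▸ mem_insert_self i s)
    · simp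
    · intro s _
      by_cases his : i ∈ s <;> simp [his]

/-- The polarization identity. -/
theorem symProd_eq_sum_pow {m : ℕ} (x : Fin m → A) :
    symProd K m A x = ((m.factorial : K)⁻¹ * (-1) ^ m) •
      ∑ s : Finset (Fin m), (-1 : K) ^ #s • (∑ i ∈ s, x i) ^ m := by
  classical
  have h1 : ∀ s : Finset (Fin m), (∑ i ∈ s, x i) ^ m =
      ∑ r : Fin m → Fin m, if ∀ i, r i ∈ s then (List.ofFn fun i => x (r i)).prod else 0 := by
    intro s
    have := (MultilinearMap.mkPiAlgebraFin K m A).map_sum_finset (fun _ => x) fun _ => s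
    rw [MultilinearMap.mkPiAlgebraFin_apply_const] at this
    rw [this, ← sum_filter]
    simp only [MultilinearMap.mkPiAlgebraFin_apply]
    congr 1
    ext r
    simp
  have h2 : ∑ s : Finset (Fin m), (-1 : K) ^ #s • (∑ i ∈ s, x i) ^ m =
      ∑ r : Fin m → Fin m, (if Function.Bijective r then (-1 : K) ^ m else 0) •
        (List.ofFn fun i => x (r i)).prod := by
    simp only [h1, ← sum_neg_one_pow_card_of_range_subset, smul_sum, sum_smul]
    rw [sum_comm]
    refine sum_congr rfl fun r _ => sum_congr rfl fun s _ => ?_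
    split_ifs <;> simp
  rw [h2, symProd_apply, mul_smul]
  congr 1
  simp only [ite_smul, zero_smul]
  rw [← sum_filter, ← smul_sum, smul_smul, ← mul_pow]
  simp only [mul_neg, mul_one, neg_neg, one_pow, one_smul]
  refine sum_bij' (fun σ _ => ⇑σ) (fun r hr => Equiv.ofBijective r (mem_filter.1 hr).2) ?_ ?_ ?_ ?_ ?_
  · intro σ _
    exact mem_filter.2 ⟨mem_univ _, σ.bijective⟩
  · simp
  · intro σ _
    ext
    simp
  · intro r _
    rfl
  · intro σ _
    rfl

end SymProd

/-- Under an arbitrary linear order on `κ`, both families have the same sorted form; compose one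
sorting permutation with the inverse of the other. -/
theorem exists_perm_of_ofFn_perm {κ : Type*} {m : ℕ} {f g : Fin m → κ}
    (h : (List.ofFn f).Perm (List.ofFn g)) : ∃ σ : Equiv.Perm (Fin m), g = f ∘ σ := by
  classical
  let : LinearOrder κ := linearOrderOfSTO WellOrderingRel
  have h1 : f ∘ Tuple.sort f = g ∘ Tuple.sort g := by
    refine List.ofFn_injective ?_
    refine List.Perm.eq_of_pairwise' (r := (· ≤ ·)) (Tuple.monotone_sort f).sortedLE_ofFn.pairwise
      (Tuple.monotone_sort g).sortedLE_ofFn.pairwise ?_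
    exact ((Tuple.sort f).ofFn_comp_perm f).trans (h.trans ((Tuple.sort g).ofFn_comp_perm g).symm)
  refine ⟨Tuple.sort f * (Tuple.sort g)⁻¹, ?_⟩
  rw [Equiv.Perm.coe_mul, ← Function.comp_assoc, h1, Function.comp_assoc, ← Equiv.Perm.coe_mul]
  simp

/-! ### Symmetrization, and regular versus symmetric polynomials. -/

section Symmetrization

variable {K κ L : Type*} [Field K] [LieRing L] [LieAlgebra K L]

theorem ofLie_basis (b : Module.Basis κ K L) (i : κ) : ofLie b (b i) = FreeAlgebra.ι K i := by
  simp [ofLie, linForm]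

/-- The projection from the non-commutative polynomials to the symmetric algebra. -/
noncomputable def toSym (b : Module.Basis κ K L) : Poly K κ →ₐ[K] SymmetricAlgebra K L :=
  FreeAlgebra.lift K fun i => SymmetricAlgebra.ι K L (b i)

theorem algHom_ofLie {A : Type*} [Ring A] [Algebra K A] (b : Module.Basis κ K L)
    (f : Poly K κ →ₐ[K] A) (g : L →ₗ[K] A) (h : ∀ i, f (FreeAlgebra.ι K i) = g (b i)) (x : L) :
    f (ofLie b x) = g x := by
  have : f.toLinearMap ∘ₗ ofLie b = g := b.ext fun i => by simp [ofLie_basis, h]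
  exact LinearMap.congr_fun this x

@[simp]
theorem toSym_ofLie (b : Module.Basis κ K L) (x : L) :
    toSym b (ofLie b x) = SymmetricAlgebra.ι K L x :=
  algHom_ofLie b _ _ (by simp [toSym]) x

theorem toSym_surjective (b : Module.Basis κ K L) : Function.Surjective (toSym b) := by
  intro s
  induction s using SymmetricAlgebra.induction with
  | algebraMap r => exact ⟨algebraMap K _ r, AlgHom.commutes _ _⟩
  | ι x => exact ⟨ofLie b x, toSym_ofLie b x⟩
  | mul s t hs ht =>
    obtain ⟨p, rfl⟩ := hs
    obtain ⟨q, rfl⟩ := ht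
    exact ⟨p * q, map_mul _ _ _⟩
  | add s t hs ht =>
    obtain ⟨p, rfl⟩ := hs
    obtain ⟨q, rfl⟩ := ht
    exact ⟨p + q, map_add _ _ _⟩

/-- Symmetrization, as a linear map from the symmetric algebra to the non-commutative
polynomials. -/
noncomputable def symmetrize (b : Module.Basis κ K L) : SymmetricAlgebra K L →ₗ[K] Poly K κ :=
  b.symmetricAlgebra.constr K fun α =>
    symProd K _ (Poly K κ) fun i => FreeAlgebra.ι K ((Finsupp.toMultiset α).toList.get i)

/-- The arbitrary ordering of the multiset in the definition of `symmetrize` is harmless because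
`symProd` is invariant under permutations. -/
theorem symmetrize_prod_basis (b : Module.Basis κ K L) {m : ℕ} (g : Fin m → κ) :
    symmetrize b (∏ j, SymmetricAlgebra.ι K L (b (g j))) =
      symProd K m (Poly K κ) fun j => FreeAlgebra.ι K (g j) := by
  classical
  set α : κ →₀ ℕ := ∑ j, Finsupp.single (g j) 1 with hα
  have h1 : b.symmetricAlgebra α = ∏ j, SymmetricAlgebra.ι K L (b (g j)) := by
    have : (MvPolynomial.monomial α (1 : K)) = ∏ j, MvPolynomial.X (g j) := by
      rw [hα, MvPolynomial.monomial_sum_one]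
      rfl
    simp [Module.Basis.symmetricAlgebra, this, map_prod]
  rw [← h1, symmetrize, Module.Basis.constr_basis]
  have h2 : (Finsupp.toMultiset α).toList.Perm (List.ofFn g) := by
    rw [← Multiset.coe_eq_coe, Multiset.coe_toList, hα, map_sum, ← Fin.univ_val_map,
      ← Multiset.sum_map_singleton (univ.val.map g), Multiset.map_map]
    simp [Finset.sum]
  generalize (Finsupp.toMultiset α).toList = l at h2
  have hl : l.length = m := by simpa using h2.length_eq
  subst hl
  obtain ⟨σ, rfl⟩ := exists_perm_of_ofFn_perm (f := l.get) (by simpa using h2)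
  exact (symProd_comp_perm (fun i => FreeAlgebra.ι K (l.get i)) σ).symm

theorem symmetrize_prod (b : Module.Basis κ K L) {m : ℕ} (x : Fin m → L) :
    symmetrize b (∏ j, SymmetricAlgebra.ι K L (x j)) =
      symProd K m (Poly K κ) fun j => ofLie b (x j) := by
  have : (symmetrize b).compMultilinearMap
      ((MultilinearMap.mkPiAlgebra K (Fin m) (SymmetricAlgebra K L)).compLinearMap
        fun _ => SymmetricAlgebra.ι K L) =
      (symProd K m (Poly K κ)).compLinearMap fun _ => ofLie b := by
    refine Module.Basis.ext_multilinear (fun _ => b) fun v => ?_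
    simp [ofLie_basis, symmetrize_prod_basis]
  simpa using DFunLike.congr_fun this x

/-- The non-commutative monomials. -/
noncomputable def word (K : Type*) {κ : Type*} [Field K] (l : List κ) : Poly K κ :=
  (l.map (FreeAlgebra.ι K)).prod

theorem word_append (l l' : List κ) : word K (l ++ l') = word K l * word K l' := by
  simp [word]

theorem word_cons (i : κ) (l : List κ) : word K (i :: l) = FreeAlgebra.ι K i * word K l := by
  simp [word]

theorem word_ofFn {m : ℕ} (g : Fin m → κ) :
    word K (List.ofFn g) = (List.ofFn fun i => FreeAlgebra.ι K (g i)).prod := by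
  simp [word, List.map_ofFn, Function.comp_def]

theorem equivMonoidAlgebra_word (l : List κ) :
    FreeAlgebra.equivMonoidAlgebraFreeMonoid (word K l) =
      MonoidAlgebra.of K (FreeMonoid κ) (FreeMonoid.ofList l) := by
  induction l with
  | nil => simp [word, MonoidAlgebra.one_def]
  | cons i l ih =>
    rw [word_cons, map_mul, ih, FreeMonoid.ofList_cons, map_mul]
    simp [FreeAlgebra.equivMonoidAlgebraFreeMonoid]

theorem coeff_word [DecidableEq κ] (l u : List κ) :
    coeff (word K l) u = if l = u then 1 else 0 := by
  rw [coeff, equivMonoidAlgebra_word]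
  simp only [MonoidAlgebra.of_apply, MonoidAlgebra.coeff_single]
  exact Finsupp.single_apply (M := K) (α := List κ) (a := l) (a' := u) (b := 1)

theorem coeff_add (p q : Poly K κ) (u : List κ) : coeff (p + q) u = coeff p u + coeff q u := by
  simp [coeff]

theorem coeff_smul (c : K) (p : Poly K κ) (u : List κ) : coeff (c • p) u = c * coeff p u := by
  simp [coeff]

/-- The coefficient of a monomial, as a linear map. -/
noncomputable def coeffₗ (u : List κ) : Poly K κ →ₗ[K] K where
  toFun p := coeff p u
  map_add' p q := coeff_add p q u
  map_smul' c p := coeff_smul c p u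

theorem coeffₗ_apply (u : List κ) (p : Poly K κ) : coeffₗ u p = coeff p u := rfl

theorem poly_ext {p q : Poly K κ} (h : ∀ u, coeff p u = coeff q u) : p = q := by
  apply FreeAlgebra.equivMonoidAlgebraFreeMonoid.injective
  ext u
  exact h (FreeMonoid.toList u)

theorem span_word : Submodule.span K (Set.range (word K (κ := κ))) = ⊤ := by
  rw [eq_top_iff]
  rintro p -
  induction p using FreeAlgebra.induction with
  | grade0 r =>
    rw [Algebra.algebraMap_eq_smul_one]
    exact Submodule.smul_mem _ _ (Submodule.subset_span ⟨[], by simp [word]⟩)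
  | grade1 i => exact Submodule.subset_span ⟨[i], by simp [word]⟩
  | mul p q hp hq =>
    have := Submodule.mul_mem_mul hp hq
    rw [Submodule.span_mul_span] at this
    refine Submodule.span_mono ?_ this
    rintro _ ⟨_, ⟨l, rfl⟩, _, ⟨l', rfl⟩, rfl⟩
    exact ⟨l ++ l', word_append l l'⟩
  | add p q hp hq => exact Submodule.add_mem _ hp hq

theorem linearMap_ext_word {M : Type*} [AddCommGroup M] [Module K M] {f g : Poly K κ →ₗ[K] M}
    (h : ∀ l, f (word K l) = g (word K l)) : f = g :=
  LinearMap.ext_on_range span_word h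

theorem symmetrize_toSym_word (b : Module.Basis κ K L) {m : ℕ} (g : Fin m → κ) :
    symmetrize b (toSym b (word K (List.ofFn g))) =
      symProd K m (Poly K κ) fun j => FreeAlgebra.ι K (g j) := by
  rw [← symmetrize_prod_basis b, word_ofFn]
  simp [map_list_prod, List.map_ofFn, List.prod_ofFn, toSym]

/-- By linearity it is enough to test words. Averaging over rearrangements of the letters has
symmetric output, and in characteristic zero it fixes symmetric polynomials. -/
theorem coeff_symmetrize_toSym (b : Module.Basis κ K L) (q : Poly K κ) {m : ℕ} (v : Fin m → κ) :
    coeff (symmetrize b (toSym b q)) (List.ofFn v) =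
      (m.factorial : K)⁻¹ * ∑ σ : Equiv.Perm (Fin m), coeff q (List.ofFn (v ∘ σ)) := by
  classical
  have : coeffₗ (List.ofFn v) ∘ₗ symmetrize b ∘ₗ (toSym b).toLinearMap =
      (m.factorial : K)⁻¹ • ∑ σ : Equiv.Perm (Fin m), coeffₗ (List.ofFn (v ∘ σ)) := by
    refine linearMap_ext_word fun l => ?_
    obtain ⟨n, g, rfl⟩ : ∃ n, ∃ g : Fin n → κ, l = List.ofFn g := ⟨_, l.get, by simp⟩
    simp only [LinearMap.comp_apply, AlgHom.toLinearMap_apply, symmetrize_toSym_word,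
      symProd_apply, map_smul, map_sum, LinearMap.smul_apply, LinearMap.sum_apply, coeffₗ_apply,
      ← word_ofFn, coeff_word]
    by_cases hn : n = m
    · subst hn
      congr 1
      refine Fintype.sum_equiv (Equiv.inv (Equiv.Perm (Fin n))) _ _ fun σ => ?_
      have : (fun i => g (σ i)) = v ↔ g = v ∘ ⇑(σ⁻¹) := by
        constructor
        · rintro rfl
          ext
          simp
        · rintro rfl
          ext
          simp
      simp [List.ofFn_inj, this]
    · have h : ∀ (f : Fin n → κ) (f' : Fin m → κ), List.ofFn f ≠ List.ofFn f' := fun f f' h =>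
        hn (by simpa using congrArg List.length h)
      simp [h]
  simpa [coeffₗ_apply] using DFunLike.congr_fun this q

theorem isSymmetric_symmetrize_toSym (b : Module.Basis κ K L) (q : Poly K κ) :
    IsSymmetric (symmetrize b (toSym b q)) := by
  intro u v h
  obtain ⟨m, f, rfl⟩ : ∃ n, ∃ f : Fin n → κ, u = List.ofFn f := ⟨_, u.get, by simp⟩
  obtain ⟨n, g, rfl⟩ : ∃ n, ∃ f : Fin n → κ, v = List.ofFn f := ⟨_, v.get, by simp⟩
  obtain rfl : m = n := by simpa using h.length_eq
  obtain ⟨τ, rfl⟩ := exists_perm_of_ofFn_perm h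
  rw [coeff_symmetrize_toSym, coeff_symmetrize_toSym]
  congr 1
  exact (Fintype.sum_equiv (Equiv.mulLeft τ) _ _ fun σ => rfl).symm

theorem linForm_eq_ofLie (b : Module.Basis κ K L) (c : κ →₀ K) :
    linForm K κ c = ofLie b (b.repr.symm c) := by
  simp [ofLie]

theorem ofLie_pow_mem_regular (b : Module.Basis κ K L) (x : L) (m : ℕ) :
    ofLie b x ^ m ∈ regular K κ :=
  Submodule.subset_span ⟨b.repr x, m, rfl⟩

theorem symProd_ofLie_mem_regular (b : Module.Basis κ K L) {m : ℕ} (x : Fin m → L) :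
    symProd K m (Poly K κ) (fun j => ofLie b (x j)) ∈ regular K κ := by
  rw [symProd_eq_sum_pow]
  refine Submodule.smul_mem _ _ (Submodule.sum_mem _ fun s _ => Submodule.smul_mem _ _ ?_)
  rw [← map_sum]
  exact ofLie_pow_mem_regular b _ m

theorem symmetrize_mem_regular (b : Module.Basis κ K L) (s : SymmetricAlgebra K L) :
    symmetrize b s ∈ regular K κ := by
  obtain ⟨q, rfl⟩ := toSym_surjective b s
  have : q ∈ Submodule.span K (Set.range (word K (κ := κ))) := by simp [span_word]
  induction this using Submodule.span_induction with
  | mem q hq =>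
    obtain ⟨l, rfl⟩ := hq
    obtain ⟨n, g, rfl⟩ : ∃ n, ∃ g : Fin n → κ, l = List.ofFn g := ⟨_, l.get, by simp⟩
    rw [symmetrize_toSym_word]
    simpa [ofLie_basis] using symProd_ofLie_mem_regular b fun j => b (g j)
  | zero => simp
  | add p q _ _ hp hq => simpa using Submodule.add_mem _ hp hq
  | smul c p _ hp => simpa using Submodule.smul_mem _ c hp

variable [CharZero K]

theorem symmetrize_ι_pow (b : Module.Basis κ K L) (x : L) (m : ℕ) :
    symmetrize b (SymmetricAlgebra.ι K L x ^ m) = ofLie b x ^ m := by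
  simpa [symProd_const] using symmetrize_prod b fun _ : Fin m => x

theorem symmetrize_toSym_of_isSymmetric (b : Module.Basis κ K L) {q : Poly K κ}
    (hq : IsSymmetric q) : symmetrize b (toSym b q) = q := by
  refine poly_ext fun u => ?_
  obtain ⟨m, f, rfl⟩ : ∃ n, ∃ f : Fin n → κ, u = List.ofFn f := ⟨_, u.get, by simp⟩
  rw [coeff_symmetrize_toSym]
  have : ∀ σ : Equiv.Perm (Fin m), coeff q (List.ofFn (f ∘ σ)) = coeff q (List.ofFn f) :=
    fun σ => hq _ _ (σ.ofFn_comp_perm f)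
  simp only [this, sum_const, card_univ, Fintype.card_perm, Fintype.card_fin]
  rw [nsmul_eq_mul, inv_mul_cancel_left₀ (Nat.cast_ne_zero.2 m.factorial_ne_zero)]

theorem symmetrize_toSym_of_mem_regular (b : Module.Basis κ K L) {q : Poly K κ}
    (hq : q ∈ regular K κ) : symmetrize b (toSym b q) = q := by
  induction hq using Submodule.span_induction with
  | mem q hq =>
    obtain ⟨c, m, rfl⟩ := hq
    rw [linForm_eq_ofLie b, map_pow, toSym_ofLie, symmetrize_ι_pow]
  | zero => simp
  | add p q _ _ hp hq => simp [hp, hq]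
  | smul c p _ hp => simp [hp]

theorem toSym_symmetrize (b : Module.Basis κ K L) (s : SymmetricAlgebra K L) :
    toSym b (symmetrize b s) = s := by
  obtain ⟨q, rfl⟩ := toSym_surjective b s
  have : (toSym b).toLinearMap ∘ₗ symmetrize b ∘ₗ (toSym b).toLinearMap =
      (toSym b).toLinearMap := by
    refine linearMap_ext_word fun l => ?_
    obtain ⟨n, g, rfl⟩ : ∃ n, ∃ g : Fin n → κ, l = List.ofFn g := ⟨_, l.get, by simp⟩
    simp only [LinearMap.comp_apply, AlgHom.toLinearMap_apply, symmetrize_toSym_word, map_symProd,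
      symProd_eq_prod]
    rw [word_ofFn, map_list_prod, List.map_ofFn, List.prod_ofFn]
  exact LinearMap.congr_fun this q

theorem mem_regular_iff_isSymmetric (b : Module.Basis κ K L) (q : Poly K κ) :
    q ∈ regular K κ ↔ IsSymmetric q := by
  refine ⟨fun h => ?_, fun h => ?_⟩
  · rw [← symmetrize_toSym_of_mem_regular b h]
    exact isSymmetric_symmetrize_toSym b q
  · rw [← symmetrize_toSym_of_isSymmetric b h]
    exact symmetrize_mem_regular b _

/-- Powers of elements of `L` span `S(L)`: every element is the projection of its symmetrization,
which is regular. -/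
theorem linearMap_ext_ι_pow (b : Module.Basis κ K L) {M : Type*} [AddCommGroup M] [Module K M]
    {f g : SymmetricAlgebra K L →ₗ[K] M}
    (h : ∀ x m, f (SymmetricAlgebra.ι K L x ^ m) = g (SymmetricAlgebra.ι K L x ^ m)) : f = g := by
  ext s
  rw [← toSym_symmetrize b s]
  have := symmetrize_mem_regular b s
  generalize symmetrize b s = q at this
  induction this using Submodule.span_induction with
  | mem q hq =>
    obtain ⟨c, m, rfl⟩ := hq
    rw [linForm_eq_ofLie b, map_pow, toSym_ofLie, h]
  | zero => simp
  | add p q _ _ hp hq => simp [hp, hq]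
  | smul c p _ hp => simp [hp]

end Symmetrization

/-! ### First-order differentiation of vector-valued polynomial functions. -/

section Jets

variable {K M N P : Type*} [Field K] [AddCommGroup M] [Module K M] [AddCommGroup N] [Module K N]
  [AddCommGroup P] [Module K P]

variable (K M) in
/-- The polynomial functions of one variable with values in a vector space. -/
def polyFun : Submodule K (K → M) :=
  Submodule.span K {f | ∃ (n : ℕ) (a : M), f = fun t => t ^ n • a}

theorem polyFun_const (a : M) : (fun _ => a) ∈ polyFun K M :=
  Submodule.subset_span ⟨0, a, by simp⟩

theorem polyFun_pow_smul {f : K → M} (hf : f ∈ polyFun K M) (n : ℕ) :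
    (fun t => t ^ n • f t) ∈ polyFun K M := by
  induction hf using Submodule.span_induction with
  | mem f hf =>
    obtain ⟨k, a, rfl⟩ := hf
    exact Submodule.subset_span ⟨n + k, a, by simp [smul_smul, pow_add]⟩
  | zero => simpa using polyFun_const (K := K) (0 : M)
  | add f g _ _ hf hg => simpa [smul_add] using! Submodule.add_mem _ hf hg
  | smul c f _ hf => simpa [smul_comm _ c] using! Submodule.smul_mem _ c hf

theorem polyFun_map (φ : M →ₗ[K] N) {f : K → M} (hf : f ∈ polyFun K M) :
    (fun t => φ (f t)) ∈ polyFun K N := by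
  induction hf using Submodule.span_induction with
  | mem f hf =>
    obtain ⟨k, a, rfl⟩ := hf
    exact Submodule.subset_span ⟨k, φ a, by simp⟩
  | zero => simpa using polyFun_const (K := K) (0 : N)
  | add f g _ _ hf hg => simpa using! Submodule.add_mem _ hf hg
  | smul c f _ hf => simpa using! Submodule.smul_mem _ c hf

theorem polyFun_map₂ (B : M →ₗ[K] N →ₗ[K] P) {f : K → M} {g : K → N} (hf : f ∈ polyFun K M)
    (hg : g ∈ polyFun K N) : (fun t => B (f t) (g t)) ∈ polyFun K P := by
  induction hf using Submodule.span_induction with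
  | mem f hf =>
    obtain ⟨k, a, rfl⟩ := hf
    simpa using polyFun_pow_smul (polyFun_map (B a) hg) k
  | zero => simpa using polyFun_const (K := K) (0 : P)
  | add f g _ _ hf hg => simpa using! Submodule.add_mem _ hf hg
  | smul c f _ hf => simpa using! Submodule.smul_mem _ c hf

theorem exists_polynomial_of_mem_polyFun {f : K → K} (hf : f ∈ polyFun K K) :
    ∃ p : Polynomial K, ∀ t, f t = p.eval t := by
  induction hf using Submodule.span_induction with
  | mem f hf =>
    obtain ⟨k, a, rfl⟩ := hf
    exact ⟨.X ^ k * .C a, fun t => by simp [mul_comm a]⟩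
  | zero => exact ⟨0, by simp⟩
  | add f g _ _ hf hg =>
    obtain ⟨p, hp⟩ := hf
    obtain ⟨q, hq⟩ := hg
    exact ⟨p + q, by simp [hp, hq]⟩
  | smul c f _ hf =>
    obtain ⟨p, hp⟩ := hf
    exact ⟨.C c * p, by simp [hp]⟩

/-- `f` is a polynomial function of the form `a + t c + t² (…)`. -/
def HasJet (f : K → M) (a c : M) : Prop :=
  ∃ g ∈ polyFun K M, ∀ t, f t = a + t • c + t ^ 2 • g t

theorem hasJet_const (a : M) : HasJet (fun _ : K => a) a 0 :=
  ⟨0, Submodule.zero_mem _, by simp⟩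

theorem hasJet_affine (a c : M) : HasJet (fun t : K => a + t • c) a c :=
  ⟨0, Submodule.zero_mem _, by simp⟩

theorem HasJet.add {f g : K → M} {a c a' c' : M} (hf : HasJet f a c) (hg : HasJet g a' c') :
    HasJet (fun t => f t + g t) (a + a') (c + c') := by
  obtain ⟨f', hf', hf⟩ := hf
  obtain ⟨g', hg', hg⟩ := hg
  refine ⟨f' + g', Submodule.add_mem _ hf' hg', fun t => ?_⟩
  simp only [hf, hg, Pi.add_apply, smul_add]
  abel

theorem HasJet.map (φ : M →ₗ[K] N) {f : K → M} {a c : M} (hf : HasJet f a c) :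
    HasJet (fun t => φ (f t)) (φ a) (φ c) := by
  obtain ⟨f', hf', hf⟩ := hf
  exact ⟨fun t => φ (f' t), polyFun_map φ hf', fun t => by simp [hf]⟩

theorem HasJet.sub {f g : K → M} {a c a' c' : M} (hf : HasJet f a c) (hg : HasJet g a' c') :
    HasJet (fun t => f t - g t) (a - a') (c - c') := by
  simpa [sub_eq_add_neg] using hf.add (hg.map (-LinearMap.id))

theorem HasJet.sum {ι : Type*} (s : Finset ι) {f : ι → K → M} {a c : ι → M}
    (h : ∀ i ∈ s, HasJet (f i) (a i) (c i)) :
    HasJet (fun t => ∑ i ∈ s, f i t) (∑ i ∈ s, a i) (∑ i ∈ s, c i) := by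
  classical
  induction s using Finset.induction_on with
  | empty => simpa using hasJet_const (K := K) (0 : M)
  | insert i s his ih =>
    simp only [sum_insert his]
    exact (h i (mem_insert_self i s)).add (ih fun j hj => h j (mem_insert_of_mem hj))

theorem HasJet.map₂ (B : M →ₗ[K] N →ₗ[K] P) {f : K → M} {g : K → N} {a c : M} {a' c' : N}
    (hf : HasJet f a c) (hg : HasJet g a' c') :
    HasJet (fun t => B (f t) (g t)) (B a a') (B c a' + B a c') := by
  obtain ⟨f', hf', hf⟩ := hf
  obtain ⟨g', hg', hg⟩ := hg
  refine ⟨fun t => B a (g' t) + B c c' + B (f' t) a' + t ^ 1 • (B c (g' t) + B (f' t) c') +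
    t ^ 2 • B (f' t) (g' t), ?_, fun t => ?_⟩
  · have h1 := polyFun_map (B a) hg'
    have h2 := polyFun_map (B c) hg'
    have h3 := polyFun_map (B.flip a') hf'
    have h4 := polyFun_map (B.flip c') hf'
    have h5 := polyFun_map₂ B hf' hg'
    exact add_mem (add_mem (add_mem (add_mem h1 (polyFun_const _)) h3)
      (polyFun_pow_smul (add_mem h2 h4) 1)) (polyFun_pow_smul h5 2)
  · simp only [hf, hg, map_add, LinearMap.add_apply, map_smul, LinearMap.smul_apply]
    module

/-- Linear functionals reduce this to scalar polynomials. Over an infinite field one that vanishes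
everywhere is zero, and `c` is read off from the coefficient of `X`. -/
theorem HasJet.eq_zero_of_forall [CharZero K] {f : K → M} {a c : M} (hf : HasJet f a c)
    (h : ∀ t, f t = 0) : c = 0 := by
  obtain ⟨g, hg, hf⟩ := hf
  have ha : a = 0 := by simpa [h] using (hf 0).symm
  subst ha
  rw [← Module.forall_dual_apply_eq_zero_iff K]
  intro φ
  obtain ⟨p, hp⟩ := exists_polynomial_of_mem_polyFun (polyFun_map φ hg)
  have h0 : Polynomial.C (φ c) * .X + .X ^ 2 * p = 0 := by
    refine Polynomial.funext fun t => ?_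
    have := congrArg φ (hf t)
    simp only [h, map_zero, zero_add, map_add, map_smul, hp, smul_eq_mul] at this
    simp only [Polynomial.eval_add, Polynomial.eval_mul, Polynomial.eval_C, Polynomial.eval_X,
      Polynomial.eval_pow, Polynomial.eval_zero, this]
    ring
  simpa [Polynomial.coeff_X_pow_mul'] using congrArg (Polynomial.coeff · 1) h0

end Jets

/-- Associativity of the Cauchy product. -/
theorem sum_antidiagonal_assoc {M : Type*} [AddCommMonoid M] (m : ℕ) (f : ℕ → ℕ → ℕ → M) :
    ∑ p ∈ antidiagonal m, ∑ q ∈ antidiagonal p.2, f p.1 q.1 q.2 =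
      ∑ p ∈ antidiagonal m, ∑ q ∈ antidiagonal p.1, f q.1 q.2 p.2 := by
  rw [sum_sigma', sum_sigma']
  refine sum_nbij' (fun ⟨⟨i, _⟩, ⟨k, l⟩⟩ => ⟨(i + k, l), (i, k)⟩)
    (fun ⟨⟨_, j⟩, ⟨k, l⟩⟩ => ⟨(k, l + j), (l, j)⟩) ?_ ?_ ?_ ?_ fun _ _ => rfl <;>
  · rintro ⟨⟨i, j⟩, ⟨k, l⟩⟩ h
    simp only [mem_sigma, HasAntidiagonal.mem_antidiagonal] at h ⊢
    obtain ⟨rfl, rfl⟩ := h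
    simp [add_assoc]

/-! ### Derivatives of powers of `ad y` and the Maurer–Cartan equation. -/

section Deriv

variable {K L : Type*} [Field K] [LieRing L] [LieAlgebra K L]

open LieAlgebra (ad)

/-- The derivative of `(ad y) ^ k v` with respect to `y` in the direction `u`. -/
def adPowDeriv (y u v : L) : ℕ → L
  | 0 => 0
  | k + 1 => ⁅y, adPowDeriv y u v k⁆ + ⁅u, (fun z => ⁅y, z⁆)^[k] v⁆

variable (K) in
theorem ad_pow_eq_iterate (y v : L) (k : ℕ) :
    (ad K L y ^ k) v = (fun z => ⁅y, z⁆)^[k] v := by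
  rw [Module.End.pow_apply]
  rfl

theorem hasJet_ad_pow (y u v : L) (k : ℕ) :
    HasJet (fun t : K => (ad K L (y + t • u) ^ k) v) ((ad K L y ^ k) v) (adPowDeriv y u v k) := by
  induction k with
  | zero => simpa using! hasJet_const v
  | succ k ih =>
    have := (hasJet_affine (K := K) y u).map₂ (ad K L : L →ₗ[K] Module.End K L) ih
    simp only [LieHom.coe_toLinearMap] at this
    simp only [pow_succ', Module.End.mul_apply]
    convert this using 1
    simp [adPowDeriv, ← ad_pow_eq_iterate K, add_comm]

/-- The sequence `0, v, ⁅y, v⁆, ⁅y, ⁅y, v⁆⁆, …`. -/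
def shiftedAd (y v : L) : ℕ → L
  | 0 => 0
  | k + 1 => (fun z => ⁅y, z⁆)^[k] v

theorem lie_shiftedAd (y v : L) (k : ℕ) :
    ⁅y, shiftedAd y v k⁆ = shiftedAd y v (k + 1) - if k = 0 then v else 0 := by
  cases k with
  | zero => simp [shiftedAd]
  | succ k => simp [shiftedAd, Function.iterate_succ_apply']

/-- Induction on `k`: `ad y` is a derivation of the bracket and shifts `shiftedAd`, so Pascal's rule
applies. The defect of the shift at index `0` produces exactly the two new brackets in the recursion
for `adPowDeriv`. -/
theorem adPowDeriv_sub (y u v : L) (k : ℕ) :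
    adPowDeriv y u v k - adPowDeriv y v u k =
      ∑ p ∈ antidiagonal (k + 1),
        (k + 1).choose p.1 • ⁅shiftedAd y u p.1, shiftedAd y v p.2⁆ := by
  induction k with
  | zero => simp [adPowDeriv, Finset.Nat.antidiagonal_succ, shiftedAd]
  | succ k ih =>
    have h1 : adPowDeriv y u v (k + 1) - adPowDeriv y v u (k + 1) =
        ⁅y, adPowDeriv y u v k - adPowDeriv y v u k⁆ + ⁅u, shiftedAd y v (k + 1)⁆ +
          ⁅shiftedAd y u (k + 1), v⁆ := by
      rw [← lie_skew (shiftedAd y u (k + 1)) v]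
      simp only [adPowDeriv, shiftedAd, lie_sub]
      abel
    have h2 : ∑ p ∈ antidiagonal (k + 1), (k + 1).choose p.1 •
        ⁅if p.1 = 0 then u else 0, shiftedAd y v p.2⁆ = ⁅u, shiftedAd y v (k + 1)⁆ := by
      rw [sum_eq_single (0, k + 1)]
      · simp
      · rintro ⟨p, q⟩ hp hne
        have : p ≠ 0 := by
          rintro rfl
          exact hne (by simpa using mem_antidiagonal.1 hp)
        simp [this]
      · simp
    have h3 : ∑ p ∈ antidiagonal (k + 1), (k + 1).choose p.1 •
        ⁅shiftedAd y u p.1, if p.2 = 0 then v else 0⁆ = ⁅shiftedAd y u (k + 1), v⁆ := by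
      rw [sum_eq_single (k + 1, 0)]
      · simp
      · rintro ⟨p, q⟩ hp hne
        have : q ≠ 0 := by
          rintro rfl
          exact hne (by simpa using mem_antidiagonal.1 hp)
        simp [this]
      · simp
    rw [Finset.sum_antidiagonal_choose_succ_nsmul (M := L)
      (fun i j => ⁅shiftedAd y u i, shiftedAd y v j⁆) (k + 1), h1, ih, ← h2, ← h3, lie_sum, add_assoc, ← sum_add_distrib,
      ← sum_add_distrib, ← sum_add_distrib]
    refine sum_congr rfl fun p hp => ?_
    rw [← Nat.choose_symm_of_eq_add (mem_antidiagonal.1 hp).symm, lie_nsmul, leibniz_lie,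
      lie_shiftedAd, lie_shiftedAd, ← nsmul_add, ← nsmul_add, ← nsmul_add]
    congr 1
    rw [sub_lie, lie_sub]
    abel

variable [CharZero K]

variable (K) in
/-- The coefficients of `(exp (ad y) - 1) / ad y`. -/
noncomputable def expAd (y : L) (k : ℕ) : Module.End K L :=
  ((k + 1).factorial : K)⁻¹ • ad K L y ^ k

omit [CharZero K] in
theorem hasJet_expAd (y u v : L) (k : ℕ) :
    HasJet (fun t : K => expAd K (y + t • u) k v) (expAd K y k v)
      (((k + 1).factorial : K)⁻¹ • adPowDeriv y u v k) :=
  (hasJet_ad_pow y u v k).map (((k + 1).factorial : K)⁻¹ • (LinearMap.id : L →ₗ[K] L))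

/-- The Maurer–Cartan equation. -/
theorem smul_adPowDeriv_sub (y u v : L) (k : ℕ) :
    ((k + 2).factorial : K)⁻¹ • (adPowDeriv y u v (k + 1) - adPowDeriv y v u (k + 1)) =
      ∑ p ∈ antidiagonal k, ⁅expAd K y p.1 u, expAd K y p.2 v⁆ := by
  -- Both end terms of the sum over `antidiagonal (k + 2)` vanish because `shiftedAd` starts with
  -- `0`; the remaining indices are `(p.1 + 1, p.2 + 1)`.
  rw [adPowDeriv_sub, Finset.Nat.sum_antidiagonal_succ, Finset.Nat.sum_antidiagonal_succ']
  simp only [shiftedAd, zero_lie, lie_zero, smul_zero, zero_add, smul_sum]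
  refine sum_congr rfl fun p hp => ?_
  obtain rfl := mem_antidiagonal.1 hp
  simp only [expAd, LinearMap.smul_apply, smul_lie, lie_smul, smul_smul, ad_pow_eq_iterate]
  rw [← Nat.cast_smul_eq_nsmul K, smul_smul]
  congr 1
  have h := Nat.add_choose_mul_factorial_mul_factorial (p.2 + 1) (p.1 + 1)
  rw [show p.2 + 1 + (p.1 + 1) = p.1 + p.2 + 2 by ring] at h
  have h0 : ∀ n : ℕ, (n.factorial : K) ≠ 0 := fun n => Nat.cast_ne_zero.2 n.factorial_ne_zero
  have h1 := h0 (p.1 + 1)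
  have h2 := h0 (p.2 + 1)
  have h3 := h0 (p.1 + p.2 + 2)
  rw [show p.1 + p.2 + 1 + 1 = p.1 + p.2 + 2 by ring]
  field_simp
  rw [← h]
  push_cast
  ring

end Deriv

/-! ### The representation of `L` on its symmetric algebra. -/

section Representation

variable {K κ L : Type*} [Field K] [LieRing L] [LieAlgebra K L]

open LieAlgebra (ad)

local notation "ιₛ" => SymmetricAlgebra.ι K L

/-- The action of an element of `L` on sequences of linear maps from `L` to its symmetric algebra
by "shift composed with `ad y`, plus multiplication by `y`". -/
noncomputable def shiftAct :
    L →ₗ[K] Module.End K (ℕ → L →ₗ[K] SymmetricAlgebra K L) :=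
  LinearMap.mk₂ K
    (fun y h k => h (k + 1) ∘ₗ ad K L y + LinearMap.mulLeft K (ιₛ y) ∘ₗ h k)
    (fun y z h => by
      ext k v
      simp only [map_add, LinearMap.comp_apply, LinearMap.add_apply, Pi.add_apply,
        LinearMap.mulLeft_apply, add_mul]
      abel)
    (fun c y h => by
      ext k v
      simp)
    (fun y h h' => by
      ext k v
      simp only [Pi.add_apply, LinearMap.comp_apply, LinearMap.add_apply,
        LinearMap.mulLeft_apply, mul_add]
      abel)
    (fun c y h => by
      ext k v
      simp)

theorem shiftAct_apply (y : L) (h : ℕ → L →ₗ[K] SymmetricAlgebra K L) (k : ℕ) (v : L) :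
    shiftAct y h k v = h (k + 1) ⁅y, v⁆ + ιₛ y * h k v := rfl

/-- The binomial theorem: "shift composed with `ad y`" and multiplication by `y` commute. -/
theorem shiftAct_pow_apply (y : L) (m : ℕ) (h : ℕ → L →ₗ[K] SymmetricAlgebra K L) (k : ℕ)
    (v : L) : (shiftAct y ^ m) h k v =
      ∑ p ∈ antidiagonal m, m.choose p.1 • (ιₛ y ^ p.2 * h (k + p.1) ((ad K L y ^ p.1) v)) := by
  induction m generalizing h with
  | zero => simp
  | succ m ih =>
    rw [pow_succ, Module.End.mul_apply, ih, Finset.sum_antidiagonal_choose_succ_nsmul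
      (fun i j => ιₛ y ^ j * h (k + i) ((ad K L y ^ i) v)) m, ← sum_add_distrib]
    refine sum_congr rfl fun p hp => ?_
    rw [← Nat.choose_symm_of_eq_add (HasAntidiagonal.mem_antidiagonal.1 hp).symm, ← nsmul_add,
      shiftAct_apply, pow_succ' (ad K L y), Module.End.mul_apply, LieAlgebra.ad_apply, add_assoc]
    ring

variable [CharZero K]

/-- Left multiplication by elements of `L` on the universal enveloping algebra, transported to
the symmetric algebra by symmetrization. -/
noncomputable def leftAct (b : Module.Basis κ K L) :
    L →ₗ[K] Module.End K (SymmetricAlgebra K L) :=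
  LinearMap.mk₂ K
    -- Since `symmetrize` sends `y ^ m` to a power of a linear form, this evaluates to `shiftAct y ^
    -- m` on the Bernoulli sequence, read at entry `0`. Passing through the free algebra makes
    -- linearity in `s` automatic.
    (fun v s => FreeAlgebra.lift K (fun i => shiftAct (b i)) (symmetrize b s)
      (fun k => ((bernoulli k : ℚ) : K) • ιₛ) 0 v)
    (fun v w s => by simp) (fun c v s => by simp) (fun v s t => by simp) (fun c v s => by simp)

variable (K) in
/-- The divided powers `y ^ m / m!`. -/
noncomputable def dpow (y : L) (m : ℕ) : SymmetricAlgebra K L := (m.factorial : K)⁻¹ • ιₛ y ^ m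

/-- The degree `m` part of `ρ(v) e^y = ((ad y / (e^{ad y} - 1)) v) e^y`. -/
theorem leftAct_dpow (b : Module.Basis κ K L) (v y : L) (m : ℕ) :
    leftAct b v (dpow K y m) = ∑ p ∈ antidiagonal m,
      ((bernoulli p.1 : ℚ) / p.1.factorial : K) • (ιₛ ((ad K L y ^ p.1) v) * dpow K y p.2) := by
  have h : leftAct b v (ιₛ y ^ m) = (shiftAct y ^ m) (fun k => ((bernoulli k : ℚ) : K) • ιₛ) 0 v := by
    simp only [leftAct, LinearMap.mk₂_apply, symmetrize_ι_pow, map_pow]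
    rw [algHom_ofLie b (FreeAlgebra.lift K fun i => shiftAct (b i)) (shiftAct (K := K) (L := L))
      (by simp)]
  rw [dpow, map_smul, h, shiftAct_pow_apply, smul_sum]
  refine sum_congr rfl fun p hp => ?_
  obtain rfl := HasAntidiagonal.mem_antidiagonal.1 hp
  have h0 : ∀ n : ℕ, (n.factorial : K) ≠ 0 := fun n => Nat.cast_ne_zero.2 n.factorial_ne_zero
  simp only [dpow, zero_add, LinearMap.smul_apply, mul_smul_comm, ← Nat.cast_smul_eq_nsmul K,
    mul_comm (ιₛ y ^ p.2), smul_mul_assoc, smul_smul]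
  congr 1
  rw [Nat.cast_add_choose]
  have h1 := h0 p.1
  have h2 := h0 p.2
  have h3 := h0 (p.1 + p.2)
  field_simp

/-- The series `(e^z - 1)/z` and `z/(e^z - 1)` are inverse to each other. -/
theorem sum_bernoulli_antidiagonal (n : ℕ) :
    ∑ p ∈ antidiagonal n, (((p.1 + 1).factorial : K)⁻¹ * ((bernoulli p.2 : ℚ) / p.2.factorial)) =
      if n = 0 then 1 else 0 := by
  have h := bernoulli_spec' n
  rw [← Finset.Nat.sum_antidiagonal_swap] at h
  have h' := congrArg (fun q : ℚ => (n.factorial : K)⁻¹ * (q : K)) h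
  have hn : (n.factorial : K)⁻¹ * ((if n = 0 then 1 else 0 : ℚ) : K) = if n = 0 then 1 else 0 := by
    split_ifs with hn <;> simp [hn]
  simp only [hn] at h'
  rw [← h', Rat.cast_sum, mul_sum]
  refine sum_congr rfl fun p hp => ?_
  obtain rfl := HasAntidiagonal.mem_antidiagonal.1 hp
  have h0 : ∀ n : ℕ, (n.factorial : K) ≠ 0 := fun n => Nat.cast_ne_zero.2 n.factorial_ne_zero
  have h1 := h0 p.1
  have h2 := h0 p.2
  have h3 := h0 (p.1 + p.2)
  have h4 : (p.1 + 1 : K) ≠ 0 := by exact_mod_cast p.1.succ_ne_zero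
  simp only [Prod.fst_swap, Prod.snd_swap, add_comm p.2 p.1, Nat.factorial_succ]
  push_cast
  rw [Nat.cast_add_choose]
  field_simp

/-- The degree `m` part of `ρ(φ(ad y) v) e^y = v e^y`: the Bernoulli series in `leftAct_dpow`
cancels `φ`. -/
theorem sum_leftAct_expAd (b : Module.Basis κ K L) (v y : L) (m : ℕ) :
    ∑ p ∈ antidiagonal m, leftAct b (expAd K y p.1 v) (dpow K y p.2) = ιₛ v * dpow K y m := by
  simp only [leftAct_dpow]
  rw [sum_antidiagonal_assoc m fun i j k => ((bernoulli j : ℚ) / j.factorial : K) •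
    (ιₛ ((ad K L y ^ j) (expAd K y i v)) * dpow K y k)]
  have h : ∀ p ∈ antidiagonal m, ∑ q ∈ antidiagonal p.1,
      ((bernoulli q.2 : ℚ) / q.2.factorial : K) •
        (ιₛ ((ad K L y ^ q.2) (expAd K y q.1 v)) * dpow K y p.2) =
      (if p.1 = 0 then (1 : K) else 0) • (ιₛ ((ad K L y ^ p.1) v) * dpow K y p.2) := by
    intro p _
    rw [← sum_bernoulli_antidiagonal, sum_smul]
    refine sum_congr rfl fun q hq => ?_
    rw [expAd, LinearMap.smul_apply, map_smul, map_smul, ← Module.End.mul_apply, ← pow_add,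
      add_comm q.2, HasAntidiagonal.mem_antidiagonal.1 hq, smul_mul_assoc, smul_smul, mul_comm]
  rw [sum_congr rfl h, sum_eq_single (0, m)]
  · simp
  · rintro ⟨p, q⟩ hp hne
    have : p ≠ 0 := by
      rintro rfl
      exact hne (by simpa using HasAntidiagonal.mem_antidiagonal.1 hp)
    simp [this]
  · simp

/-- As `ad y` kills `y`, only the constant term of `φ(ad y)` contributes. -/
theorem leftAct_self (b : Module.Basis κ K L) (y : L) (m : ℕ) :
    leftAct b y (ιₛ y ^ m) = ιₛ y ^ (m + 1) := by
  have h := sum_leftAct_expAd b y y m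
  rw [sum_eq_single (0, m)] at h
  · simp only [expAd, dpow, zero_add, Nat.factorial_one, Nat.cast_one, inv_one, pow_zero, one_smul,
      Module.End.one_apply, map_smul, mul_smul_comm] at h
    rw [smul_right_injective _ (inv_ne_zero (Nat.cast_ne_zero.2 m.factorial_ne_zero)) h, pow_succ']
  · rintro ⟨p, q⟩ hp hne
    obtain _ | p := p
    · exact absurd (by simpa using HasAntidiagonal.mem_antidiagonal.1 hp) hne
    · simp [expAd, pow_succ]
  · simp

omit [CharZero K] in
theorem dpow_zero (y : L) : dpow K y 0 = 1 := by simp [dpow]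

omit [CharZero K] in
theorem dpow_succ (y : L) (m : ℕ) :
    dpow K y (m + 1) = ((m + 1 : ℕ) : K)⁻¹ • (ιₛ y * dpow K y m) := by
  rw [dpow, dpow, Nat.factorial_succ, mul_smul_comm, smul_smul, ← pow_succ', Nat.cast_mul, mul_inv]

/-- The derivative of `dpow y m` with respect to `y` in the direction `u`. -/
noncomputable def dpowDeriv (y u : L) : ℕ → SymmetricAlgebra K L
  | 0 => 0
  | m + 1 => ιₛ u * dpow K y m

theorem hasJet_dpow (y u : L) (m : ℕ) :
    HasJet (fun t : K => dpow K (y + t • u) m) (dpow K y m) (dpowDeriv y u m) := by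
  induction m with
  | zero => simpa [dpow_zero] using! hasJet_const (K := K) (1 : SymmetricAlgebra K L)
  | succ m ih =>
    have h := (((hasJet_affine (K := K) y u).map ιₛ).map₂
      (LinearMap.mul K (SymmetricAlgebra K L)) ih).map (((m + 1 : ℕ) : K)⁻¹ • LinearMap.id)
    simp only [LinearMap.smul_apply, LinearMap.id_apply, LinearMap.mul_apply', ← dpow_succ] at h
    convert h using 1
    have hm : ((m + 1 : ℕ) : K) ≠ 0 := Nat.cast_ne_zero.2 m.succ_ne_zero
    rw [eq_inv_smul_iff₀ hm, dpowDeriv]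
    cases m with
    | zero => simp [dpowDeriv]
    | succ m =>
      have hm' : ((m + 1 : ℕ) : K) ≠ 0 := Nat.cast_ne_zero.2 m.succ_ne_zero
      have : ιₛ y * (ιₛ u * dpow K y m) = ((m + 1 : ℕ) : K) • (ιₛ u * dpow K y (m + 1)) := by
        rw [dpow_succ, mul_smul_comm, smul_smul, mul_inv_cancel₀ hm', one_smul]
        ring
      rw [dpowDeriv, this, Nat.cast_succ (m + 1), add_smul, one_smul, add_comm]

/-- The derivative of `sum_leftAct_expAd` in `y` along `u`, obtained by comparing jets along the
line `y + t • u`. -/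
theorem sum_leftAct_deriv (b : Module.Basis κ K L) (u v y : L) (m : ℕ) :
    ∑ p ∈ antidiagonal m,
      (leftAct b (((p.1 + 2).factorial : K)⁻¹ • adPowDeriv y u v (p.1 + 1)) (dpow K y p.2) +
        leftAct b (expAd K y p.1 v) (ιₛ u * dpow K y p.2)) = ιₛ v * (ιₛ u * dpow K y m) := by
  have h1 : HasJet (fun t : K => ∑ p ∈ antidiagonal (m + 1),
      leftAct b (expAd K (y + t • u) p.1 v) (dpow K (y + t • u) p.2)) _ _ :=
    HasJet.sum _ fun p _ => (hasJet_expAd y u v p.1).map₂ (leftAct b) (hasJet_dpow y u p.2)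
  have h2 := (hasJet_dpow (K := K) y u (m + 1)).map (LinearMap.mulLeft K (ιₛ v))
  have h := (h1.sub h2).eq_zero_of_forall fun t => by
    simp [sum_leftAct_expAd]
  -- The identity was differentiated in degree `m + 1`, since differentiation lowers the degree in
  -- `y` by one. The two terms peeled off are derivatives of constants.
  rw [sub_eq_zero, sum_add_distrib, Finset.Nat.sum_antidiagonal_succ,
    Finset.Nat.sum_antidiagonal_succ'] at h
  simpa [adPowDeriv, dpowDeriv, sum_add_distrib] using h

/-- Exchange `u` and `v` in `sum_leftAct_deriv` and subtract: the right sides agree by commutativity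
of `S(L)`. On the left, Maurer–Cartan gives `ρ` of the bracket, while rewriting `u e^y` as `ρ(φ(ad
y) u) e^y` gives the commutator. -/
theorem sum_leftAct_lie (b : Module.Basis κ K L) (u v y : L) (m : ℕ) :
    ∑ p ∈ antidiagonal m, ∑ q ∈ antidiagonal p.1,
      (leftAct b ⁅expAd K y q.1 u, expAd K y q.2 v⁆ -
        ⁅leftAct b (expAd K y q.1 u), leftAct b (expAd K y q.2 v)⁆) (dpow K y p.2) = 0 := by
  have key : ∀ u v : L, ∑ p ∈ antidiagonal m, leftAct b (expAd K y p.1 v) (ιₛ u * dpow K y p.2) =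
      ∑ p ∈ antidiagonal m, ∑ q ∈ antidiagonal p.1,
        leftAct b (expAd K y q.1 v) (leftAct b (expAd K y q.2 u) (dpow K y p.2)) := by
    intro u v
    simp only [← sum_leftAct_expAd b, map_sum]
    exact sum_antidiagonal_assoc m fun i j k =>
      leftAct b (expAd K y i v) (leftAct b (expAd K y j u) (dpow K y k))
  have hmc : ∀ k, ∑ q ∈ antidiagonal k, leftAct b ⁅expAd K y q.1 u, expAd K y q.2 v⁆ =
      leftAct b (((k + 2).factorial : K)⁻¹ • adPowDeriv y u v (k + 1)) -
        leftAct b (((k + 2).factorial : K)⁻¹ • adPowDeriv y v u (k + 1)) := by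
    intro k
    rw [← map_sum, ← smul_adPowDeriv_sub, smul_sub, map_sub]
  have h1 := sum_leftAct_deriv b u v y m
  have h2 := sum_leftAct_deriv b v u y m
  rw [mul_left_comm, ← h2, sum_add_distrib, sum_add_distrib, key, key] at h1
  have h3 : ∀ p : ℕ × ℕ, ∑ q ∈ antidiagonal p.1,
      leftAct b (expAd K y q.1 v) (leftAct b (expAd K y q.2 u) (dpow K y p.2)) =
      ∑ q ∈ antidiagonal p.1,
        leftAct b (expAd K y q.2 v) (leftAct b (expAd K y q.1 u) (dpow K y p.2)) := fun p =>
    (Finset.Nat.sum_antidiagonal_swap (f := fun q : ℕ × ℕ =>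
      leftAct b (expAd K y q.1 v) (leftAct b (expAd K y q.2 u) (dpow K y p.2)))).symm
  simp only [h3] at h1
  simp only [LinearMap.sub_apply, sum_sub_distrib, ← LinearMap.sum_apply, hmc,
    LieRing.of_associative_ring_bracket]
  simp only [LinearMap.sum_apply, Module.End.mul_apply]
  linear_combination h1

/-- In `sum_leftAct_lie`, the term `(0, m)` involves only the constant term `1` of `φ`; every other
term acts on a lower divided power and vanishes by induction, which is why `u` and `v` stay
quantified. -/
theorem leftAct_lie_dpow (b : Module.Basis κ K L) (y : L) (m : ℕ) : ∀ u v : L,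
    (leftAct b ⁅u, v⁆ - ⁅leftAct b u, leftAct b v⁆) (dpow K y m) = 0 := by
  induction m using Nat.strong_induction_on with
  | h m ih =>
    intro u v
    have h := sum_leftAct_lie b u v y m
    rw [sum_eq_single (0, m)] at h
    · simpa [expAd] using h
    · rintro ⟨p, q⟩ hp hne
      have hp' := HasAntidiagonal.mem_antidiagonal.1 hp
      refine sum_eq_zero fun r _ => ih q ?_ _ _
      refine lt_of_le_of_ne (by simp at hp'; omega) ?_
      rintro rfl
      exact hne (by simpa using hp')
    · simp

theorem leftAct_lie (b : Module.Basis κ K L) (u v : L) :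
    leftAct b ⁅u, v⁆ = ⁅leftAct b u, leftAct b v⁆ := by
  rw [← sub_eq_zero]
  refine linearMap_ext_ι_pow b fun y m => ?_
  have h := leftAct_lie_dpow b y m u v
  rw [dpow, map_smul, smul_eq_zero_iff_right
    (inv_ne_zero (Nat.cast_ne_zero.2 m.factorial_ne_zero))] at h
  simpa using h

end Representation

/-! ### Reduction to regular polynomials and comparison with `U(L)`. -/

section Equivalence

variable {K κ L : Type*} [Field K] [LieRing L] [LieAlgebra K L]

attribute [local instance 100] LieRing.ofAssociativeRing

theorem map_eq_zero_of_mem_trinomialSums {A : Type*} [Ring A] [Algebra K A]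
    (b : Module.Basis κ K L) (f : Poly K κ →ₐ[K] A) (g : L →ₗ⁅K⁆ A)
    (h : ∀ i, f (FreeAlgebra.ι K i) = g (b i)) {p : Poly K κ} (hp : p ∈ trinomialSums b) :
    f p = 0 := by
  have hf : ∀ x, f (ofLie b x) = g x := algHom_ofLie b f (g : L →ₗ[K] A) h
  induction hp using Submodule.span_induction with
  | mem q hq =>
    obtain ⟨P, x, y, Q, rfl⟩ := hq
    simp [trinomial, hf, LieRing.of_associative_ring_bracket]
  | zero => simp
  | add p q _ _ hp hq => simp [hp, hq]
  | smul c p _ hp => simp [hp]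

theorem mul_ofLie_mul_mem (b : Module.Basis κ K L) (W : Submodule K (Poly K κ)) (p q : List κ)
    (h : ∀ i, word K (p ++ i :: q) ∈ W) (x : L) : word K p * ofLie b x * word K q ∈ W := by
  rw [ofLie, LinearMap.comp_apply, linForm, Finsupp.linearCombination_apply, Finsupp.sum, mul_sum,
    sum_mul]
  refine Submodule.sum_mem _ fun i _ => ?_
  rw [mul_smul_comm, smul_mul_assoc]
  refine Submodule.smul_mem _ _ ?_
  have := h i
  rwa [word_append, word_cons, ← mul_assoc] at this

/-- An adjacent exchange changes a word by a trinomial product plus a term with a bracket in place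
of two letters, a combination of shorter words. The free prefix `p` lets the induction pass under a
leading letter. -/
theorem word_sub_word_mem (b : Module.Basis κ K L) (W : Submodule K (Poly K κ))
    (hW : trinomialSums b ≤ W) {m : ℕ} (ih : ∀ l : List κ, l.length < m → word K l ∈ W)
    {l l' : List κ} (h : l.Perm l') :
    ∀ p : List κ, (p ++ l).length = m → word K (p ++ l) - word K (p ++ l') ∈ W := by
  induction h with
  | nil => simp
  | @cons i l l' _ hl =>
    intro p hp
    simpa using hl (p ++ [i]) (by simpa using hp)
  | swap i j l =>
    intro p hp
    have h1 : trinomial b (word K p) (b j) (b i) (word K l) ∈ W :=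
      hW (Submodule.subset_span ⟨_, _, _, _, rfl⟩)
    have h2 := mul_ofLie_mul_mem b W p l (fun k => ih _ (by simp at hp ⊢; omega)) ⁅b j, b i⁆
    convert add_mem h1 h2 using 1
    simp only [trinomial, word_append, word_cons, ofLie_basis]
    noncomm_ring
  | @trans l₁ l₂ l₃ h₁₂ _ h1 h2 =>
    intro p hp
    have := add_mem (h1 p hp) (h2 p (by simpa [h₁₂.length_eq] using hp))
    simpa using this

variable [CharZero K]

theorem word_mem_sup (b : Module.Basis κ K L) (m : ℕ) :
    ∀ l : List κ, l.length = m → word K l ∈ regular K κ ⊔ trinomialSums b := by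
  induction m using Nat.strong_induction_on with
  | h m ih =>
    intro l hl
    obtain ⟨g, rfl⟩ : ∃ g : Fin m → κ, l = List.ofFn g := ⟨fun i => l.get (i.cast hl.symm), by
      subst hl
      simp⟩
    have h1 : symProd K m (Poly K κ) (fun j => FreeAlgebra.ι K (g j)) ∈
        regular K κ ⊔ trinomialSums b := by
      refine Submodule.mem_sup_left ?_
      simpa [ofLie_basis] using symProd_ofLie_mem_regular b fun j => b (g j)
    have h2 : ∀ σ : Equiv.Perm (Fin m), word K (List.ofFn g) - word K (List.ofFn (g ∘ σ)) ∈
        regular K κ ⊔ trinomialSums b := fun σ =>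
      word_sub_word_mem b _ le_sup_right (fun l' hl' => ih _ hl' l' rfl)
        (σ.ofFn_comp_perm g).symm [] (by simp)
    -- A word is its symmetrization plus the average of its differences from its rearrangements.
    have h3 := add_mem h1 (Submodule.smul_mem _ (m.factorial : K)⁻¹
      (Submodule.sum_mem _ fun σ (_ : σ ∈ univ) => h2 σ))
    convert h3 using 1
    rw [symProd_apply, ← smul_add, ← sum_add_distrib]
    simp only [← word_ofFn, Function.comp_def, add_sub_cancel, sum_const, card_univ,
      Fintype.card_perm, Fintype.card_fin]
    rw [← Nat.cast_smul_eq_nsmul K, smul_smul,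
      inv_mul_cancel₀ (Nat.cast_ne_zero.2 m.factorial_ne_zero), one_smul]

theorem exists_regular_equivalent (b : Module.Basis κ K L) (p : Poly K κ) :
    ∃ r ∈ regular K κ, Equivalent b p r := by
  have h : p ∈ regular K κ ⊔ trinomialSums b := by
    have : (⊤ : Submodule K (Poly K κ)) ≤ regular K κ ⊔ trinomialSums b := by
      rw [← span_word, Submodule.span_le]
      rintro _ ⟨l, rfl⟩
      exact word_mem_sup b _ l rfl
    exact this Submodule.mem_top
  obtain ⟨r, hr, s, hs, rfl⟩ := Submodule.mem_sup.1 h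
  exact ⟨r, hr, by simpa [Equivalent] using hs⟩

/-- `leftAct` as a representation of `L`. -/
noncomputable def leftRep (b : Module.Basis κ K L) :
    L →ₗ⁅K⁆ Module.End K (SymmetricAlgebra K L) :=
  { leftAct b with map_lie' := fun {x y} => leftAct_lie b x y }

theorem leftRep_pow_one (b : Module.Basis κ K L) (y : L) (m : ℕ) :
    (leftRep b y ^ m) 1 = SymmetricAlgebra.ι K L y ^ m := by
  induction m with
  | zero => simp
  | succ m ih =>
    rw [pow_succ', Module.End.mul_apply, ih]
    exact leftAct_self b y m

/-- The linear map from the universal enveloping algebra to the symmetric algebra given by acting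
on `1`. -/
noncomputable def desymmetrize (b : Module.Basis κ K L) :
    UniversalEnvelopingAlgebra K L →ₗ[K] SymmetricAlgebra K L :=
  LinearMap.applyₗ 1 ∘ₗ (UniversalEnvelopingAlgebra.lift K (leftRep b)).toLinearMap

/-- The projection from the non-commutative polynomials to the universal enveloping algebra. -/
noncomputable def toEnveloping (b : Module.Basis κ K L) :
    Poly K κ →ₐ[K] UniversalEnvelopingAlgebra K L :=
  FreeAlgebra.lift K fun i => UniversalEnvelopingAlgebra.ι K (b i)

omit [CharZero K] in
theorem toEnveloping_ofLie (b : Module.Basis κ K L) (x : L) :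
    toEnveloping b (ofLie b x) = UniversalEnvelopingAlgebra.ι K x :=
  algHom_ofLie b (toEnveloping b)
    (UniversalEnvelopingAlgebra.ι K : L →ₗ⁅K⁆ UniversalEnvelopingAlgebra K L).toLinearMap
    (by simp [toEnveloping]) x

omit [CharZero K] in
theorem toEnveloping_eq_zero (b : Module.Basis κ K L) {p : Poly K κ} (hp : p ∈ trinomialSums b) :
    toEnveloping b p = 0 :=
  map_eq_zero_of_mem_trinomialSums b (toEnveloping b) (UniversalEnvelopingAlgebra.ι K)
    (by simp [toEnveloping]) hp

omit [CharZero K] in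
-- The range contains the image of `L`, so the universal property maps `U(L)` into it; followed by
-- inclusion, this is the identity.
theorem toEnveloping_surjective (b : Module.Basis κ K L) :
    Function.Surjective (toEnveloping b) := by
  have h : (toEnveloping b).range = ⊤ := by
    let g : L →ₗ⁅K⁆ (toEnveloping b).range :=
      { toFun x := ⟨UniversalEnvelopingAlgebra.ι K x, ofLie b x, toEnveloping_ofLie b x⟩
        map_add' x y := Subtype.ext (map_add _ _ _)
        map_smul' c x := Subtype.ext (map_smul _ _ _)
        map_lie' := fun {x y} => Subtype.ext (LieHom.map_lie _ _ _) }
    have hg : (toEnveloping b).range.val.comp (UniversalEnvelopingAlgebra.lift K g) =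
        AlgHom.id K _ := by
      ext x
      simp [g]
    rw [eq_top_iff]
    intro u _
    rw [← AlgHom.id_apply (R := K) u, ← hg]
    exact Subtype.property _
  exact (AlgHom.range_eq_top _).1 h

theorem desymmetrize_toEnveloping_symmetrize (b : Module.Basis κ K L)
    (s : SymmetricAlgebra K L) : desymmetrize b (toEnveloping b (symmetrize b s)) = s := by
  have : desymmetrize b ∘ₗ (toEnveloping b).toLinearMap ∘ₗ symmetrize b = LinearMap.id := by
    refine linearMap_ext_ι_pow b fun y m => ?_
    simp only [LinearMap.comp_apply, symmetrize_ι_pow, AlgHom.toLinearMap_apply, map_pow,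
      toEnveloping_ofLie, desymmetrize, UniversalEnvelopingAlgebra.lift_ι_apply,
      LinearMap.applyₗ_apply_apply, leftRep_pow_one, LinearMap.id_apply]
  exact LinearMap.congr_fun this s

/-- A regular `s` is the symmetrization of `toSym b s`, which `desymmetrize` recovers from the image
of `s` in `U(L)`; that image is zero. -/
theorem eq_zero_of_mem_trinomialSums_of_mem_regular (b : Module.Basis κ K L) {s : Poly K κ}
    (hs : s ∈ trinomialSums b) (hr : s ∈ regular K κ) : s = 0 := by
  have h := desymmetrize_toEnveloping_symmetrize b (toSym b s)
  rw [symmetrize_toSym_of_mem_regular b hr, toEnveloping_eq_zero b hs, map_zero] at h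
  rw [← symmetrize_toSym_of_mem_regular b hr, ← h, map_zero]

/-- Symmetrization, as a linear isomorphism from the symmetric algebra to the universal enveloping
algebra. -/
noncomputable def symmetrizeEquiv (b : Module.Basis κ K L) :
    SymmetricAlgebra K L ≃ₗ[K] UniversalEnvelopingAlgebra K L :=
  LinearEquiv.ofBijective ((toEnveloping b).toLinearMap ∘ₗ symmetrize b) <| by
    refine ⟨Function.LeftInverse.injective (g := desymmetrize b)
      (desymmetrize_toEnveloping_symmetrize b), fun u => ?_⟩
    obtain ⟨p, rfl⟩ := toEnveloping_surjective b u
    obtain ⟨r, hr, hpr⟩ := exists_regular_equivalent b p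
    refine ⟨toSym b r, ?_⟩
    have := toEnveloping_eq_zero b hpr
    rw [map_sub, sub_eq_zero] at this
    simp [symmetrize_toSym_of_mem_regular b hr, this]

theorem symmetrizeEquiv_prod (b : Module.Basis κ K L) {m : ℕ} (x : Fin m → L) :
    symmetrizeEquiv b (∏ i, SymmetricAlgebra.ι K L (x i)) =
      (m.factorial : K)⁻¹ • ∑ σ : Equiv.Perm (Fin m),
        (List.ofFn fun i => UniversalEnvelopingAlgebra.ι K (x (σ i))).prod := by
  have : symmetrizeEquiv b (∏ i, SymmetricAlgebra.ι K L (x i)) =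
      toEnveloping b (symmetrize b (∏ i, SymmetricAlgebra.ι K L (x i))) := rfl
  rw [this, symmetrize_prod, map_symProd, symProd_apply]
  simp [toEnveloping_ofLie]

end Equivalence

end SymbolicPoly

theorem theorem3p8 {K κ L : Type*} [Field K] [CharZero K] [LieRing L] [LieAlgebra K L]
    (b : Module.Basis κ K L) :
    -- every polynomial is equivalent to exactly one regular polynomial
    (∀ p : SymbolicPoly.Poly K κ,
      ∃! r : SymbolicPoly.Poly K κ, r ∈ SymbolicPoly.regular K κ ∧ SymbolicPoly.Equivalent b p r) ∧
    -- the regular polynomials are the symmetric ones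
    (∀ p : SymbolicPoly.Poly K κ, p ∈ SymbolicPoly.regular K κ ↔ SymbolicPoly.IsSymmetric p) ∧
    -- every regular sum of trinomial products is zero
    (∀ s ∈ SymbolicPoly.trinomialSums b, s ∈ SymbolicPoly.regular K κ → s = 0) ∧
    -- symmetrization is a linear isomorphism from the symmetric algebra onto `U(L)`
    (∃ ω : SymmetricAlgebra K L ≃ₗ[K] UniversalEnvelopingAlgebra K L,
      ∀ (m : ℕ) (x : Fin m → L),
        ω (∏ i, SymmetricAlgebra.ι K L (x i)) =
          (m.factorial : K)⁻¹ • ∑ σ : Equiv.Perm (Fin m),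
            (List.ofFn fun i => UniversalEnvelopingAlgebra.ι K (x (σ i))).prod) := by
  refine ⟨fun p => ?_, SymbolicPoly.mem_regular_iff_isSymmetric b,
    fun s => SymbolicPoly.eq_zero_of_mem_trinomialSums_of_mem_regular b,
    SymbolicPoly.symmetrizeEquiv b, fun m => SymbolicPoly.symmetrizeEquiv_prod b⟩
  obtain ⟨r, hr, hpr⟩ := SymbolicPoly.exists_regular_equivalent b p
  refine ⟨r, ⟨hr, hpr⟩, ?_⟩
  rintro r' ⟨hr', hpr'⟩
  rw [← sub_eq_zero]
  refine SymbolicPoly.eq_zero_of_mem_trinomialSums_of_mem_regular b ?_ (Submodule.sub_mem _ hr' hr)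
  have := Submodule.sub_mem _ hpr hpr'
  rwa [sub_sub_sub_cancel_left] at this
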